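/- Let $\mathbb{H}$ be a Hilbert space over $K$ ($K=\mathbb{R}$ or $\mathbb{C}$), and let $\mathbb{L}(\mathbb{H})$ be the space of bounded linear operators on $\mathbb{H}$ with the operator norm. For $T\in\mathbb{L}(\mathbb{H})$ put $M_T=\{x\in\mathbb{H}:\|x\|=1,\ \|Tx\|=\|T\|\}$. For a linear subspace $\mathcal{W}$ of $\mathbb{L}(\mathbb{H})$ write $T\perp_B\mathcal{W}$ ($T$ is Birkhoff-James orthogonal to $\mathcal{W}$) if $\|T+cA\|\ge\|T\|$ for all $A\in\mathcal{W}$ and all $c\in K$. Suppose that $\|T\|=1$, that $M_T=\{x\in H_0:\|x\|=1\}$ for a finite-dimensional subspace $H_0$ of $\mathbb{H}$, and that the restriction of $T$ to $H_0^\perp$ satisfies $\|T|_{H_0^\perp}\|<\|T\|$. Then for every linear subspace $\mathcal{W}$ of $\mathbb{L}(\mathbb{H})$, $T\perp_B\mathcal{W}$ if and only if there exist $n\in\mathbb{N}$, $x_1,\dots,x_n\in M_T$ and real numbers $\lambda_1,\dots,\lambda_n>0$ such that $\sum_{i=1}^n\lambda_i=1$ and $$\sum_{i=1}^n\lambda_i\langle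 Ax_i,Tx_i\rangle=0\quad\text{for all }A\in\mathcal{W}.$$ -/

import Mathlib

/-- Birkhoff-James orthogonality `x ⊥_B y` of two vectors of a normed space over `𝕜`:
`‖x + c y‖ ≥ ‖x‖` for every scalar `c`. -/
def BirkhoffJamesOrthogonal (𝕜 : Type*) {E : Type*} [RCLike 𝕜] [NormedAddCommGroup E]
    [NormedSpace 𝕜 E] (x y : E) : Prop :=
  ∀ c : 𝕜, ‖x‖ ≤ ‖x + c • y‖

/-- Birkhoff-James orthogonality `x ⊥_B W` of a vector to a linear subspace. -/
def BirkhoffJamesOrthogonalTo {𝕜 E : Type*} [RCLike 𝕜] [NormedAddCommGroup E]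
    [NormedSpace 𝕜 E] (x : E) (W : Submodule 𝕜 E) : Prop :=
  ∀ y ∈ W, BirkhoffJamesOrthogonal 𝕜 x y

/-- The norm attainment set `M_T` of a bounded operator: all unit vectors `x` with
`‖T x‖ = ‖T‖`. -/
def normAttainmentSet {𝕜 E F : Type*} [RCLike 𝕜] [NormedAddCommGroup E] [NormedSpace 𝕜 E]
    [NormedAddCommGroup F] [NormedSpace 𝕜 F] (T : E →L[𝕜] F) : Set E :=
  {x | ‖x‖ = 1 ∧ ‖T x‖ = ‖T‖}

/-!
If `0` is a convex combination of the functionals `A ↦ ⟪T x, A x⟫` on `W`, with `x` in the norm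
attainment set, then pairing `(T + c A) x` with `T x` and averaging bounds `‖T + c A‖` below by
`‖T‖` (`norm_le_norm_add_smul_of_sum_inner_eq_zero`).

Conversely, write `P` for the orthogonal projection onto `H₀`. For `x ∈ H₀` the functional
`A ↦ ⟪T x, A x⟫` depends only on the compression `P T† A` of `T† A` to `H₀`. The compressions of
elements of `W` form a finite-dimensional space, so the functionals range over a compact subset of
a finite-dimensional dual space, and by Carathéodory's theorem the convex hull of that set is
compact (`IsCompact.convexHull_of_finiteDimensional`). If `0` is not in the hull, separation and
reflexivity of finite-dimensional spaces (`exists_forall_lt_re_apply_of_zero_notMem_convexHull`)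
yield `A ∈ W` and `ε > 0` with `ε ‖x‖² ≤ re ⟪T x, A x⟫` on `H₀`.

It remains to see that `‖T - t A‖ < 1` for small `t > 0`
(`exists_norm_sub_smul_lt_one_of_le_re_inner`). As `T` is a contraction which is isometric on `H₀`,
`T† T` is the identity on `H₀`, so `T` preserves orthogonality to `H₀` and
`‖T (h + k)‖² = ‖h‖² + ‖T k‖²` for `h ∈ H₀`, `k ∈ H₀ᗮ`. The first order term `-2 t ⟪T x, A x⟫`
makes the norm smaller on `H₀`, the gap `‖T|H₀ᗮ‖ < 1` absorbs all the terms containing `k`, and the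
term of second order in `t` is negligible.
-/

open RCLike

/-! ### Convex hulls and separation in finite dimension -/

/-- By Carathéodory's theorem the convex hull is a finite union of continuous images of the compact
sets `stdSimplex ℝ (Fin k) × s ^ k`, where `k` is at most the dimension plus one. -/
theorem IsCompact.convexHull_of_finiteDimensional {E : Type*} [AddCommGroup E] [Module ℝ E]
    [TopologicalSpace E] [IsTopologicalAddGroup E] [ContinuousSMul ℝ E] [FiniteDimensional ℝ E]
    {s : Set E} (hs : IsCompact s) : IsCompact (convexHull ℝ s) := by
  have key : convexHull ℝ s = ⋃ k ∈ Set.Iic (Module.finrank ℝ E + 1),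
      (fun p : (Fin k → ℝ) × (Fin k → E) => ∑ i, p.1 i • p.2 i) ''
        (stdSimplex ℝ (Fin k) ×ˢ Set.univ.pi fun _ => s) := by
    apply Set.Subset.antisymm
    · intro x hx
      obtain ⟨ι, _, z, w, hz, hind, hw, hw1, hx⟩ := eq_pos_convex_span_of_mem_convexHull hx
      let e := (Fintype.equivFin ι).symm
      simp only [Set.mem_iUnion]
      refine ⟨Fintype.card ι, ?_, (w ∘ e, z ∘ e), ⟨⟨fun i => (hw _).le, ?_⟩, ?_⟩, ?_⟩
      · exact hind.card_le_finrank_succ.trans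
          (Nat.add_le_add_right (Submodule.finrank_le _) 1)
      · rw [← hw1]
        exact e.sum_comp w
      · exact fun i _ => hz ⟨e i, rfl⟩
      · rw [← hx]
        exact e.sum_comp fun i => w i • z i
    · simp only [Set.iUnion_subset_iff]
      rintro k - _ ⟨⟨w, z⟩, ⟨hw, hz⟩, rfl⟩
      exact mem_convexHull_of_exists_fintype w z hw.1 hw.2 (fun i => hz i trivial) rfl
  rw [key]
  refine (Set.finite_Iic _).isCompact_biUnion fun k _ => ?_
  exact ((isCompact_stdSimplex ℝ (Fin k)).prod (isCompact_univ_pi fun _ => hs)).image (by fun_prop)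

theorem exists_forall_lt_re_apply_of_zero_notMem_convexHull {𝕜 V : Type*} [RCLike 𝕜]
    [NormedAddCommGroup V] [NormedSpace 𝕜 V] [FiniteDimensional 𝕜 V] {S : Set (StrongDual 𝕜 V)}
    (hS : IsCompact S) (h0 : (0 : StrongDual 𝕜 V) ∉ convexHull ℝ S) :
    ∃ (v : V) (ε : ℝ), 0 < ε ∧ ∀ φ ∈ S, ε < re (φ v) := by
  let e : Module.Dual 𝕜 V ≃ₗ[𝕜] StrongDual 𝕜 V := LinearMap.toContinuousLinearMap
  have : FiniteDimensional 𝕜 (StrongDual 𝕜 V) := e.finiteDimensional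
  have : FiniteDimensional ℝ (StrongDual 𝕜 V) := FiniteDimensional.trans ℝ 𝕜 _
  obtain ⟨f, u, hu, hf⟩ := RCLike.geometric_hahn_banach_point_closed (𝕜 := 𝕜)
    (convex_convexHull ℝ S) hS.convexHull_of_finiteDimensional.isClosed h0
  -- The separating functional on the dual is evaluation at a vector.
  let v : V := (Module.evalEquiv 𝕜 V).symm (f.toLinearMap ∘ₗ e.toLinearMap)
  have hv (φ : StrongDual 𝕜 V) : φ v = f φ :=
    Module.apply_evalEquiv_symm_apply 𝕜 V φ.toLinearMap (f.toLinearMap ∘ₗ e.toLinearMap)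
  refine ⟨v, u, by simpa using hu, fun φ hφ => ?_⟩
  rw [hv]
  exact hf φ (subset_convexHull ℝ S hφ)

/-- A compact family of functionals on a finite-dimensional space either has a vanishing convex
combination or has uniformly positive real part at some vector. -/
theorem exists_sum_apply_eq_zero_or_exists_forall_lt_re_apply {𝕜 V X : Type*} [RCLike 𝕜]
    [NormedAddCommGroup V] [NormedSpace 𝕜 V] [FiniteDimensional 𝕜 V] {φ : X → StrongDual 𝕜 V}
    {s : Set X} (hS : IsCompact (φ '' s)) :
    (∃ (n : ℕ) (x : Fin n → X) (w : Fin n → ℝ), (∀ i, x i ∈ s) ∧ (∀ i, 0 < w i) ∧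
      ∑ i, w i = 1 ∧ ∀ v, ∑ i, (w i : 𝕜) * φ (x i) v = 0) ∨
    ∃ (v : V) (ε : ℝ), 0 < ε ∧ ∀ x ∈ s, ε < re (φ x v) := by
  by_cases h0 : (0 : StrongDual 𝕜 V) ∈ convexHull ℝ (φ '' s)
  · left
    obtain ⟨ι, _, z, w, hz, -, hw, hw1, hsum⟩ := eq_pos_convex_span_of_mem_convexHull h0
    choose x hx hxz using fun i => hz ⟨i, rfl⟩
    let e := (Fintype.equivFin ι).symm
    refine ⟨Fintype.card ι, fun i => x (e i), w ∘ e, fun i => hx _, fun i => hw _,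
      (e.sum_comp w).trans hw1, fun v => ?_⟩
    have h := congrArg (fun f : StrongDual 𝕜 V => f v) hsum
    simp only [sum_apply, smul_apply, ← hxz, zero_apply, real_smul_eq_coe_mul] at h
    rw [← h]
    exact e.sum_comp fun i => (w i : 𝕜) * φ (x i) v
  · right
    obtain ⟨v, ε, hε, h⟩ := exists_forall_lt_re_apply_of_zero_notMem_convexHull hS h0
    exact ⟨v, ε, hε, fun x hx => h _ ⟨x, hx, rfl⟩⟩

/-! ### Contractions that are isometric on a subspace -/

section Operators

variable {𝕜 E F : Type*} [RCLike 𝕜] [NormedAddCommGroup E] [InnerProductSpace 𝕜 E]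
  [NormedAddCommGroup F] [InnerProductSpace 𝕜 F]

theorem ContinuousLinearMap.inner_map_map_of_norm_map_eq [CompleteSpace E] [CompleteSpace F]
    {T : E →L[𝕜] F} (hT : ‖T‖ ≤ 1) {x : E} (hx : ‖T x‖ = ‖x‖) (y : E) :
    inner 𝕜 (T x) (T y) = inner 𝕜 x y := by
  -- Expanding `‖T† T x - x‖ ^ 2` gives at most `‖x‖ ^ 2 - 2 * ‖T x‖ ^ 2 + ‖x‖ ^ 2 = 0`.
  have hadj : T.adjoint (T x) = x := by
    have h1 : ‖T.adjoint (T x)‖ ≤ ‖x‖ := by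
      have h : ‖T.adjoint (T x)‖ ≤ 1 * ‖T x‖ :=
        T.adjoint.le_of_opNorm_le (by simpa using hT) _
      rwa [one_mul, hx] at h
    have h2 : re (inner 𝕜 (T.adjoint (T x)) x) = ‖x‖ ^ 2 := by
      rw [ContinuousLinearMap.adjoint_inner_left, inner_self_eq_norm_sq, hx]
    have h3 := norm_sub_sq (𝕜 := 𝕜) (T.adjoint (T x)) x
    have h4 : ‖T.adjoint (T x)‖ ^ 2 ≤ ‖x‖ ^ 2 := by gcongr
    have h5 : ‖T.adjoint (T x) - x‖ ^ 2 = 0 :=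
      le_antisymm (by linarith) (sq_nonneg _)
    exact sub_eq_zero.1 (norm_eq_zero.1 (pow_eq_zero_iff two_ne_zero |>.1 h5))
  rw [← ContinuousLinearMap.adjoint_inner_left, hadj]

/-- The quadratic estimate behind `exists_norm_sub_smul_lt_one_of_le_re_inner`: the variables `a`
and `b` stand for the norms of the components of a vector in `H₀` and `H₀ᗮ`. -/
theorem exists_pos_forall_quadratic_le {ε M q : ℝ} (hε : 0 < ε) (hM : 0 < M) (hq0 : 0 ≤ q)
    (hq : q < 1) :
    ∃ t δ : ℝ, 0 < t ∧ 0 ≤ δ ∧ δ < 1 ∧ ∀ a b : ℝ,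
      a ^ 2 + q ^ 2 * b ^ 2 - 2 * t * (ε * a ^ 2 - 2 * M * (a * b) - M * b ^ 2)
        + t ^ 2 * M ^ 2 * (a ^ 2 + b ^ 2) ≤ δ * (a ^ 2 + b ^ 2) := by
  have hd : 0 < 1 - q ^ 2 := by nlinarith
  have hC : 0 < ε + 2 * M + 4 * M ^ 2 / ε := by positivity
  -- The first bound on `t` makes the coefficient of `b ^ 2` at most `1 - t * ε`, like that of `a ^ 2`;
  -- the second bounds the term of second order in `t` by half of the gain `t * ε`.
  let t := min ((1 - q ^ 2) / (ε + 2 * M + 4 * M ^ 2 / ε)) (ε / (2 * M ^ 2))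
  have ht : 0 < t := lt_min (by positivity) (by positivity)
  have ht1 : t * (ε + 2 * M + 4 * M ^ 2 / ε) ≤ 1 - q ^ 2 :=
    (le_div_iff₀ hC).1 (min_le_left _ _)
  have ht2 : t * (2 * M ^ 2) ≤ ε := (le_div_iff₀ (by positivity)).1 (min_le_right _ _)
  have hδ : 0 < t * ε / 2 := by positivity
  refine ⟨t, 1 - t * ε / 2, ht, ?_, by linarith, fun a b => ?_⟩
  · have h1 : t * ε ≤ t * (ε + 2 * M + 4 * M ^ 2 / ε) := by
      gcongr
      have : 0 ≤ 2 * M + 4 * M ^ 2 / ε := by positivity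
      linarith
    nlinarith [sq_nonneg q]
  · -- Young's inequality for the mixed term.
    have hab : 4 * M * (a * b) ≤ ε * a ^ 2 + 4 * M ^ 2 / ε * b ^ 2 := by
      have h : 0 ≤ (ε * a - 2 * M * b) ^ 2 / ε := by positivity
      have h' : (ε * a - 2 * M * b) ^ 2 / ε
          = ε * a ^ 2 + 4 * M ^ 2 / ε * b ^ 2 - 4 * M * (a * b) := by
        field_simp
        ring
      linarith
    have e1 := mul_le_mul_of_nonneg_left hab ht.le
    have e2 := mul_le_mul_of_nonneg_right ht1 (sq_nonneg b)
    have e3 := mul_le_mul_of_nonneg_right (mul_le_mul_of_nonneg_left ht2 ht.le)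
      (add_nonneg (sq_nonneg a) (sq_nonneg b))
    linarith

/-- If `re ⟪T x, A x⟫` is bounded below on the subspace where a contraction `T` is isometric, and
`T` is a strict contraction on the orthogonal complement, then moving slightly from `T` in the
direction `-A` brings the norm below `1`. -/
theorem exists_norm_sub_smul_lt_one_of_le_re_inner [CompleteSpace E] [CompleteSpace F]
    {T A : E →L[𝕜] F} (hT : ‖T‖ ≤ 1) {K : Submodule 𝕜 E} [K.HasOrthogonalProjection]
    (hK : ∀ x ∈ K, ‖T x‖ = ‖x‖) (hperp : ‖T.domRestrict Kᗮ‖ < 1) {ε : ℝ} (hε : 0 < ε)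
    (hA : ∀ x ∈ K, ε * ‖x‖ ^ 2 ≤ re (inner 𝕜 (T x) (A x))) :
    ∃ t : ℝ, ‖T - (t : 𝕜) • A‖ < 1 := by
  let M := ‖A‖ + 1
  have hM : 0 < M := by positivity
  obtain ⟨t, δ, ht, hδ0, hδ, hquad⟩ := exists_pos_forall_quadratic_le hε hM (norm_nonneg _) hperp
  refine ⟨t, lt_of_le_of_lt (ContinuousLinearMap.opNorm_le_bound _ (Real.sqrt_nonneg δ)
    fun x => ?_) ((Real.sqrt_lt_sqrt hδ0 hδ).trans_eq Real.sqrt_one)⟩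
  obtain ⟨h, hh, k, hk, rfl⟩ := K.exists_add_mem_mem_orthogonal x
  have hAM (y : E) : ‖A y‖ ≤ M * ‖y‖ := A.le_of_opNorm_le (by simp [M]) y
  have hhk : inner 𝕜 h k = 0 := hk h hh
  have hpyth : ‖h + k‖ ^ 2 = ‖h‖ ^ 2 + ‖k‖ ^ 2 := by
    simp [norm_add_sq (𝕜 := 𝕜), hhk]
  have hTk : ‖T k‖ ≤ ‖T.domRestrict Kᗮ‖ * ‖k‖ := (T.domRestrict Kᗮ).le_opNorm ⟨k, hk⟩
  have hTk1 : ‖T k‖ ≤ 1 * ‖k‖ := T.le_of_opNorm_le hT k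
  have hTsq : ‖T (h + k)‖ ^ 2 ≤ ‖h‖ ^ 2 + ‖T.domRestrict Kᗮ‖ ^ 2 * ‖k‖ ^ 2 := by
    have horth : inner 𝕜 (T h) (T k) = 0 := by
      rw [ContinuousLinearMap.inner_map_map_of_norm_map_eq hT (hK h hh), hhk]
    rw [map_add, norm_add_sq (𝕜 := 𝕜), horth, hK h hh, ← mul_pow]
    simp only [map_zero, mul_zero, add_zero]
    gcongr
  have hlow (y z : E) (hy : ‖T y‖ ≤ ‖y‖) : -(M * (‖y‖ * ‖z‖)) ≤ re (inner 𝕜 (T y) (A z)) := by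
    have h1 : ‖inner 𝕜 (T y) (A z)‖ ≤ ‖y‖ * (M * ‖z‖) :=
      (norm_inner_le_norm _ _).trans (mul_le_mul hy (hAM z) (norm_nonneg _) (norm_nonneg _))
    have h2 := (abs_le.1 (abs_re_le_norm (inner 𝕜 (T y) (A z)))).1
    linarith
  have hre : ε * ‖h‖ ^ 2 - 2 * M * (‖h‖ * ‖k‖) - M * ‖k‖ ^ 2
      ≤ re (inner 𝕜 (T (h + k)) (A (h + k))) := by
    have h1 := hA h hh
    have h2 := hlow h k (hK h hh).le
    have h3 := hlow k h (by linarith)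
    have h4 := hlow k k (by linarith)
    simp only [map_add, inner_add_left, inner_add_right]
    linarith
  have hAsq : ‖A (h + k)‖ ^ 2 ≤ M ^ 2 * (‖h‖ ^ 2 + ‖k‖ ^ 2) := by
    rw [← hpyth, ← mul_pow]
    gcongr
    exact hAM _
  have hsq : ‖(T - (t : 𝕜) • A) (h + k)‖ ^ 2 ≤ δ * ‖h + k‖ ^ 2 := by
    have e : ‖(T - (t : 𝕜) • A) (h + k)‖ ^ 2 = ‖T (h + k)‖ ^ 2
        - 2 * t * re (inner 𝕜 (T (h + k)) (A (h + k))) + t ^ 2 * ‖A (h + k)‖ ^ 2 := by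
      rw [sub_apply, smul_apply, norm_sub_sq (𝕜 := 𝕜),
        inner_smul_right, re_ofReal_mul, norm_smul, norm_ofReal, mul_pow, sq_abs]
      ring
    rw [e, hpyth]
    refine le_trans ?_ (hquad ‖h‖ ‖k‖)
    have e1 := mul_le_mul_of_nonneg_left hre (by positivity : 0 ≤ 2 * t)
    have e2 := mul_le_mul_of_nonneg_left hAsq (sq_nonneg t)
    linarith
  refine le_of_sq_le_sq ?_ (by positivity)
  rwa [mul_pow, Real.sq_sqrt hδ0]

/-! ### Birkhoff-James orthogonality -/

/-- The averaged pairing of `T + c A` against `T` over norm attaining vectors equals `‖T‖²` and is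
bounded by `‖T + c A‖ ‖T‖`. -/
theorem norm_le_norm_add_smul_of_sum_inner_eq_zero {T A : E →L[𝕜] F} {ι : Type*} [Fintype ι]
    {x : ι → E} {w : ι → ℝ} (hx : ∀ i, x i ∈ normAttainmentSet T) (hw : ∀ i, 0 ≤ w i)
    (hw1 : ∑ i, w i = 1) (h0 : ∑ i, (w i : 𝕜) * inner 𝕜 (T (x i)) (A (x i)) = 0) (c : 𝕜) :
    ‖T‖ ≤ ‖T + c • A‖ := by
  have hsum : ∑ i, (w i : 𝕜) * inner 𝕜 (T (x i)) ((T + c • A) (x i)) = ((‖T‖ ^ 2 : ℝ) : 𝕜) := by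
    have hterm (i : ι) : (w i : 𝕜) * inner 𝕜 (T (x i)) ((T + c • A) (x i))
        = ((w i * ‖T‖ ^ 2 : ℝ) : 𝕜) + c * ((w i : 𝕜) * inner 𝕜 (T (x i)) (A (x i))) := by
      rw [add_apply, smul_apply, inner_add_right,
        inner_smul_right, inner_self_eq_norm_sq_to_K, (hx i).2]
      push_cast
      ring
    rw [Finset.sum_congr rfl fun i _ => hterm i, Finset.sum_add_distrib, ← Finset.mul_sum, h0,
      mul_zero, add_zero, ← ofReal_sum, ← Finset.sum_mul, hw1, one_mul]
  have hle : ‖T‖ * ‖T‖ ≤ ‖T + c • A‖ * ‖T‖ := by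
    calc ‖T‖ * ‖T‖ = ‖∑ i, (w i : 𝕜) * inner 𝕜 (T (x i)) ((T + c • A) (x i))‖ := by
          rw [hsum, norm_ofReal, abs_of_nonneg (sq_nonneg _), sq]
      _ ≤ ∑ i, w i * (‖T + c • A‖ * ‖T‖) := by
          refine norm_sum_le_of_le _ fun i _ => ?_
          rw [norm_mul, norm_ofReal, abs_of_nonneg (hw i)]
          refine mul_le_mul_of_nonneg_left ((norm_inner_le_norm _ _).trans ?_) (hw i)
          rw [(hx i).2, mul_comm]
          gcongr
          simpa [(hx i).1] using (T + c • A).le_opNorm (x i)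
      _ = ‖T + c • A‖ * ‖T‖ := by rw [← Finset.sum_mul, hw1, one_mul]
  rcases (norm_nonneg T).eq_or_lt with h | h
  · exact h ▸ norm_nonneg _
  · exact le_of_mul_le_mul_right hle h

end Operators

/-- For a finite-dimensional space `V` of operators on `K`, given by a map `L`, either the functionals
`v ↦ ⟪x, L v x⟫`, with `x` a unit vector, have a vanishing convex combination, or some `v` makes all
their real parts uniformly positive. -/
theorem exists_sum_inner_self_eq_zero_or_exists_le_re_inner_self {𝕜 K V : Type*} [RCLike 𝕜]
    [NormedAddCommGroup K] [InnerProductSpace 𝕜 K] [FiniteDimensional 𝕜 K]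
    [NormedAddCommGroup V] [NormedSpace 𝕜 V] [FiniteDimensional 𝕜 V]
    (L : V →L[𝕜] K →L[𝕜] K) :
    (∃ (n : ℕ) (x : Fin n → K) (w : Fin n → ℝ), (∀ i, ‖x i‖ = 1) ∧ (∀ i, 0 < w i) ∧
      ∑ i, w i = 1 ∧ ∀ v, ∑ i, (w i : 𝕜) * inner 𝕜 (x i) (L v (x i)) = 0) ∨
    ∃ (v : V) (ε : ℝ), 0 < ε ∧ ∀ x, ε * ‖x‖ ^ 2 ≤ re (inner 𝕜 x (L v x)) := by
  let φ (x : K) : StrongDual 𝕜 V := innerSL 𝕜 x ∘L L.flip x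
  have hφ (x : K) (v : V) : φ x v = inner 𝕜 x (L v x) := rfl
  have hφc : Continuous φ := (innerSL 𝕜).continuous.clm_comp L.flip.continuous
  have : ProperSpace K := FiniteDimensional.proper 𝕜 K
  have hS : IsCompact (φ '' Metric.sphere 0 1) := (isCompact_sphere 0 1).image hφc
  rcases exists_sum_apply_eq_zero_or_exists_forall_lt_re_apply hS with
    ⟨n, x, w, hx, hw, hw1, h⟩ | ⟨v, ε, hε, hpos⟩
  · exact Or.inl ⟨n, x, w, fun i => by simpa using hx i, hw, hw1, h⟩
  · right
    refine ⟨v, ε, hε, fun x => ?_⟩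
    rcases eq_or_ne x 0 with rfl | hx0
    · simp
    -- Normalise `x` and use that `x ↦ ⟪x, L v x⟫` is homogeneous of degree two.
    have hn : ‖x‖ ≠ 0 := norm_ne_zero_iff.2 hx0
    let y : K := ((‖x‖⁻¹ : ℝ) : 𝕜) • x
    have hy : ‖y‖ = 1 := by simp [y, norm_smul, hn]
    have h := hpos y (by simpa using hy)
    rw [hφ] at h
    have hxy : x = (‖x‖ : 𝕜) • y := by
      rw [smul_smul, ← ofReal_mul, mul_inv_cancel₀ hn, ofReal_one, one_smul]
    have hxx : re (inner 𝕜 x (L v x)) = ‖x‖ ^ 2 * re (inner 𝕜 y (L v y)) := by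
      have h1 : inner 𝕜 x (L v x) = inner 𝕜 ((‖x‖ : 𝕜) • y) (L v ((‖x‖ : 𝕜) • y)) := by rw [← hxy]
      rw [h1, map_smul, inner_smul_left, inner_smul_right, conj_ofReal, re_ofReal_mul,
        re_ofReal_mul]
      ring
    rw [hxx, mul_comm]
    exact mul_le_mul_of_nonneg_left h.le (sq_nonneg _)

/-- The previous dichotomy for the functionals `A ↦ ⟪T x, A x⟫` with `x` in a finite-dimensional
subspace `K`, which factor through compression of `T† A` to `K`. -/
theorem exists_sum_inner_eq_zero_or_exists_le_re_inner {𝕜 E F : Type*} [RCLike 𝕜]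
    [NormedAddCommGroup E] [InnerProductSpace 𝕜 E] [CompleteSpace E] [NormedAddCommGroup F]
    [InnerProductSpace 𝕜 F] [CompleteSpace F] (T : E →L[𝕜] F) (K : Submodule 𝕜 E)
    [FiniteDimensional 𝕜 K] (W : Submodule 𝕜 (E →L[𝕜] F)) :
    (∃ (n : ℕ) (x : Fin n → E) (w : Fin n → ℝ), (∀ i, x i ∈ K ∧ ‖x i‖ = 1) ∧ (∀ i, 0 < w i) ∧
      ∑ i, w i = 1 ∧ ∀ A ∈ W, ∑ i, (w i : 𝕜) * inner 𝕜 (T (x i)) (A (x i)) = 0) ∨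
    ∃ A ∈ W, ∃ ε : ℝ, 0 < ε ∧ ∀ x ∈ K, ε * ‖x‖ ^ 2 ≤ re (inner 𝕜 (T x) (A x)) := by
  let Φ : (E →L[𝕜] F) →ₗ[𝕜] (K →L[𝕜] K) :=
    (ContinuousLinearMap.compL 𝕜 K F K (K.orthogonalProjectionOnto ∘L T.adjoint) ∘L
      (ContinuousLinearMap.compL 𝕜 K E F).flip K.subtypeL).toLinearMap
  have hΦ (A : E →L[𝕜] F) (x : K) : inner 𝕜 x (Φ A x) = inner 𝕜 (T x) (A x) := by
    change inner 𝕜 x (K.orthogonalProjectionOnto (T.adjoint (A x))) = _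
    rw [Submodule.inner_orthogonalProjectionOnto_eq_of_mem_left,
      ContinuousLinearMap.adjoint_inner_right]
  have : FiniteDimensional 𝕜 (K →L[𝕜] K) :=
    (LinearMap.toContinuousLinearMap (𝕜 := 𝕜) (E := K) (F' := K)).finiteDimensional
  rcases exists_sum_inner_self_eq_zero_or_exists_le_re_inner_self (𝕜 := 𝕜) (K := K)
    (V := W.map Φ) (W.map Φ).subtypeL with
    ⟨n, x, w, hx, hw, hw1, h⟩ | ⟨⟨_, A, hA, rfl⟩, ε, hε, h⟩
  · refine Or.inl ⟨n, fun i => x i, w, fun i => ⟨(x i).2, hx i⟩, hw, hw1, fun A hA => ?_⟩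
    simpa only [Submodule.subtypeL_apply, hΦ] using h ⟨Φ A, Submodule.mem_map_of_mem hA⟩
  · refine Or.inr ⟨A, hA, ε, hε, fun x hx => ?_⟩
    simpa only [Submodule.subtypeL_apply, hΦ, Submodule.coe_norm] using h ⟨x, hx⟩

theorem mainTheorem3 {𝕜 H : Type*} [RCLike 𝕜] [NormedAddCommGroup H] [InnerProductSpace 𝕜 H]
    [CompleteSpace H] (T : H →L[𝕜] H) (hT : ‖T‖ = 1)
    (H₀ : Submodule 𝕜 H) (hfin : FiniteDimensional 𝕜 H₀)
    (hMT : normAttainmentSet T = {x : H | x ∈ H₀ ∧ ‖x‖ = 1})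
    (hperp : ‖T.domRestrict H₀ᗮ‖ < ‖T‖)
    (W : Submodule 𝕜 (H →L[𝕜] H)) :
    BirkhoffJamesOrthogonalTo T W ↔
      ∃ (n : ℕ) (x : Fin n → H) (w : Fin n → ℝ),
        (∀ i, x i ∈ normAttainmentSet T) ∧ (∀ i, 0 < w i) ∧ ∑ i, w i = 1 ∧
          ∀ A ∈ W, ∑ i, (w i : 𝕜) * inner 𝕜 (T (x i)) (A (x i)) = 0 := by
  constructor
  · intro hBJ
    rcases exists_sum_inner_eq_zero_or_exists_le_re_inner T H₀ W with
      ⟨n, x, w, hx, hw⟩ | ⟨A, hAW, ε, hε, hA⟩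
    · exact ⟨n, x, w, fun i => hMT ▸ hx i, hw⟩
    · have hiso : ∀ x ∈ H₀, ‖T x‖ = ‖x‖ := by
        intro x hx
        rcases eq_or_ne x 0 with rfl | hx0
        · simp
        have hn : ‖x‖ ≠ 0 := norm_ne_zero_iff.2 hx0
        have hy : ((‖x‖⁻¹ : ℝ) : 𝕜) • x ∈ normAttainmentSet T := by
          rw [hMT]
          exact ⟨H₀.smul_mem _ hx, by simp [norm_smul, hn]⟩
        have h := hy.2
        rw [map_smul, norm_smul, norm_ofReal, abs_of_nonneg (by positivity), hT] at h
        field_simp at h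
        exact h
      obtain ⟨t, ht⟩ := exists_norm_sub_smul_lt_one_of_le_re_inner hT.le hiso (hT ▸ hperp) hε hA
      have h := hBJ A hAW (-(t : 𝕜))
      rw [neg_smul, ← sub_eq_add_neg, hT] at h
      exact absurd ht h.not_gt
  · rintro ⟨n, x, w, hx, hw, hw1, h0⟩ A hA c
    exact norm_le_norm_add_smul_of_sum_inner_eq_zero hx (fun i => (hw i).le) hw1 (h0 A hA) c
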